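/- Theorem 2.6. Let $g(z)=e^z/(1+e^z)$ and $|v|_1=\sum_j|v_j|$. For each $n\ge1$ let $M=M_n$, let $\beta^*=\beta^*_n\in\mathbb R^M$, let $I^*=\{j:\beta^*_j\ne0\}$ and $k^*=|I^*|$, and let $(\mathbf X_i,Y_i)$, $1\le i\le n$, be independent (for example i.i.d.) random pairs in $\mathbb R^M\times\{0,1\}$ whose law may depend on $n$, such that $\mathbb E(Y_i\mid\mathbf X_i)=g(\beta^{*\prime}\mathbf X_i)$ and $|X_{ij}|\le L$ almost surely for all $i,j$, where $L>0$ does not depend on $n$. Let $\delta_n>0$ with $\delta_n\to0$, let $r=r_n$ satisfy $$r\ \ge\ (6+4\sqrt2)\,L\sqrt{\frac{2\log 2(M\vee n)}{n}}+2L\sqrt{\frac{2\log(1/\delta_n)}{n}}+\frac1{4(M\vee n)},$$ (the second square root being read as $0$ for the finitely many $n$ with $\delta_n>1$), and put $$\epsilon=\epsilon_n=\frac{\log 2}{2^{(M\vee n)+1}}\cdot\frac1r .$$ Let $\Sigma_1$ be the $M\times M$ matrix with entries $\frac1n\sum_{i=1}^n g'(\beta^{*\prime}\mathbf X_i)X_{ik}X_{ij}$.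 Assume Condition LStabil with $\alpha=3$: there is a constant $0<b\le1$, independent of $n$, such that for all $n\ge1$ and every $v\in\mathbb R^M$ with $\sum_{j\notin I^*}|v_j|\le3\sum_{j\in I^*}|v_j|+\epsilon$, $$\mathbb P\Big(v'\Sigma_1v\ge b\sum_{j\in I^*}v_j^2-\epsilon\Big)=1 .$$ Assume further that $\max_{j\in I^*}|\beta^*_j|\le B$ for some $B>0$ independent of $n$, and that $k^*r\to0$ as $n\to\infty$. Let $\tilde\beta=\tilde\beta_n$ be a measurable choice of a minimizer over $\beta\in\mathbb R^M$ of $$\frac1n\sum_{i=1}^n\big\{-Y_i\,\beta'\mathbf X_i+\log(1+\exp(\beta'\mathbf X_i))\big\}+2r|\beta|_1 .$$ Then, for every $w\in(0,1)$, $$\mathbb P\Big(|\tilde\beta-\beta^*|_1\le\frac4{wb}\,r\,k^*+\Big(1+\frac1r\Big)\epsilon\Big)\longrightarrow1\qquad(n\to\infty).$$ -/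

import Mathlib

open MeasureTheory ProbabilityTheory Filter Topology

noncomputable section

/-- The logistic link `g(z) = e^z / (1 + e^z)`. -/
def logisticLink (z : ℝ) : ℝ := Real.exp z / (1 + Real.exp z)

/-- The `ℓ₁` norm on `ℝ^M`. -/
def l1Norm {M : ℕ} (v : Fin M → ℝ) : ℝ := ∑ j, |v j|

/-- The set `I*` of indices of the non-zero components of `β`. -/
def activeSet {M : ℕ} (β : Fin M → ℝ) : Finset (Fin M) := {j | β j ≠ 0}

/-- The set `V_{α,ε}` of all `v` with `∑_{j ∉ I} |v_j| ≤ α ∑_{j ∈ I} |v_j| + ε`. -/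
def stabilSet {M : ℕ} (I : Finset (Fin M)) (α ε : ℝ) : Set (Fin M → ℝ) :=
  {v | ∑ j ∈ Iᶜ, |v j| ≤ α * ∑ j ∈ I, |v j| + ε}

/-- The weighted Gram matrix `Σ₁`, with entries `(1/n) ∑_i g'(β'x_i) x_{ik} x_{ij}`, of a design
with rows `x_1, …, x_n`. -/
def weightedGram {n M : ℕ} (β : Fin M → ℝ) (x : Fin n → Fin M → ℝ) :
    Matrix (Fin M) (Fin M) ℝ :=
  Matrix.of fun k j =>
    (1 / (n : ℝ)) * ∑ i, deriv logisticLink (dotProduct β (x i)) * x i k * x i j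

/-- Condition LStabil with parameters `α`, `ε` and constant `b`: for every `v ∈ V_{α,ε}`, almost
surely `v' Σ₁ v ≥ b ∑_{j ∈ I*} v_j² - ε`. -/
def LStabil {Ω : Type*} [MeasurableSpace Ω] (μ : Measure Ω) {n M : ℕ}
    (X : Fin n → Ω → Fin M → ℝ) (β : Fin M → ℝ) (α ε b : ℝ) : Prop :=
  ∀ v ∈ stabilSet (activeSet β) α ε, ∀ᵐ ω ∂μ,
    b * ∑ j ∈ activeSet β, v j ^ 2 - ε ≤
      dotProduct v ((weightedGram β fun i => X i ω).mulVec v)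

/-- The logistic loss `l(β; x, y) = -y β'x + log (1 + exp (β'x))`. -/
def logisticLoss {M : ℕ} (β x : Fin M → ℝ) (y : ℝ) : ℝ :=
  -y * dotProduct β x + Real.log (1 + Real.exp (dotProduct β x))

/-- The `ℓ₁` penalized empirical logistic risk with penalty `2r`. -/
def penalizedRisk {n M : ℕ} (r : ℝ) (x : Fin n → Fin M → ℝ) (y : Fin n → ℝ)
    (β : Fin M → ℝ) : ℝ :=
  (1 / (n : ℝ)) * ∑ i, logisticLoss β (x i) (y i) + 2 * r * l1Norm β

/-- The logistic regression model: the pairs `(X_i, Y_i)` are independent random elements of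
`ℝ^M × {0,1}`, the covariates are bounded by `L` and `E(Y_i | X_i) = g(β'X_i)`. -/
structure IsLogisticModel {Ω : Type*} [MeasurableSpace Ω] (μ : Measure Ω) {n M : ℕ}
    (X : Fin n → Ω → Fin M → ℝ) (Y : Fin n → Ω → ℝ) (β : Fin M → ℝ) (L : ℝ) : Prop where
  measurable_X : ∀ i, Measurable (X i)
  measurable_Y : ∀ i, Measurable (Y i)
  indep : iIndepFun (fun i ω => (X i ω, Y i ω)) μ
  binary : ∀ i, ∀ᵐ ω ∂μ, Y i ω = 0 ∨ Y i ω = 1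
  bounded : ∀ i j, ∀ᵐ ω ∂μ, |X i ω j| ≤ L
  condMean : ∀ i, μ[Y i | MeasurableSpace.comap (X i) inferInstance]
    =ᵐ[μ] fun ω => logisticLink (dotProduct β (X i ω))

/-- The lower bound that the tuning parameter `r` has to satisfy. -/
def tuningBound (L : ℝ) (M n : ℕ) (δ : ℝ) : ℝ :=
  (6 + 4 * √2) * L * √(2 * Real.log (2 * (max M n : ℕ)) / n)
    + 2 * L * √(2 * Real.log (1 / δ) / n) + 1 / (4 * (max M n : ℕ))

/-- The number `ε = (log 2 / 2^{(M ∨ n) + 1}) · (1 / r)`. -/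
def slack (M n : ℕ) (r : ℝ) : ℝ := Real.log 2 / 2 ^ (max M n + 1) * (1 / r)

end

/-! Outside an event of probability at most `1/n`, every coordinate of the score at `β*` is at most
`r` in absolute value: Hoeffding plus a union bound, `measureReal_exists_lt_abs_score_le`. The rest
is deterministic and contained in `l1Norm_sub_le_of_minimizer`.

Put `D = γ - β*` for a minimizer `γ`, and `K = 4rk*/(wb) + ε/r`. If `|D|₁ > K`, shrink `D` to `tD`
with norm slightly above `K`. Convexity gives a first order inequality at `β* + tD`. There the
linear predictors have moved so little that self-concordance bounds the gradient increment below by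
`w` times the quadratic form of `Σ₁`. With the score bound this puts `tD` in the cone of Condition
LStabil, and LStabil with Young's inequality then gives `|tD|₁ ≤ K`, a contradiction.

The shrinking makes a prior consistency proof unnecessary: it suffices that `K → 0`, which follows
from `k*r → 0` and `tendsto_slack_div`. -/

/-! ### Analysis of the logistic link. -/

theorem hasDerivAt_logisticLink (z : ℝ) :
    HasDerivAt logisticLink (Real.exp z / (1 + Real.exp z) ^ 2) z := by
  have h := (Real.hasDerivAt_exp z).div ((Real.hasDerivAt_exp z).const_add 1) (by positivity)
  refine h.congr_deriv ?_
  ring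

theorem deriv_logisticLink (z : ℝ) :
    deriv logisticLink z = Real.exp z / (1 + Real.exp z) ^ 2 :=
  (hasDerivAt_logisticLink z).deriv

theorem differentiable_logisticLink : Differentiable ℝ logisticLink :=
  fun z => (hasDerivAt_logisticLink z).differentiableAt

theorem deriv_logisticLink_nonneg (z : ℝ) : 0 ≤ deriv logisticLink z := by
  rw [deriv_logisticLink]; positivity

theorem monotone_logisticLink : Monotone logisticLink :=
  monotone_of_deriv_nonneg differentiable_logisticLink deriv_logisticLink_nonneg

theorem logisticLink_nonneg (z : ℝ) : 0 ≤ logisticLink z := by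
  unfold logisticLink; positivity

theorem logisticLink_le_one (z : ℝ) : logisticLink z ≤ 1 := by
  unfold logisticLink
  rw [div_le_one (by positivity)]
  linarith

/-- Self-concordance of the logistic link. -/
theorem exp_neg_abs_mul_deriv_logisticLink_le (z s : ℝ) :
    Real.exp (-|s|) * deriv logisticLink z ≤ deriv logisticLink (z + s) := by
  rw [deriv_logisticLink, deriv_logisticLink, Real.exp_add, ← mul_div_assoc,
    div_le_div_iff₀ (by positivity) (by positivity)]
  have hz := Real.exp_pos z
  have hs := Real.exp_pos s
  rcases le_total 0 s with h | h
  · have h1 : 1 ≤ Real.exp s := Real.one_le_exp h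
    have h2 : 1 + Real.exp z * Real.exp s ≤ Real.exp s * (1 + Real.exp z) := by linarith
    have h3 := pow_le_pow_left₀ (by positivity) h2 2
    rw [abs_of_nonneg h, Real.exp_neg]
    calc (Real.exp s)⁻¹ * Real.exp z * (1 + Real.exp z * Real.exp s) ^ 2
        ≤ (Real.exp s)⁻¹ * Real.exp z * (Real.exp s * (1 + Real.exp z)) ^ 2 := by gcongr
      _ = Real.exp z * Real.exp s * (1 + Real.exp z) ^ 2 := by field_simp
  · have h1 : Real.exp s ≤ 1 := Real.exp_le_one_iff.2 h
    have h2 : 1 + Real.exp z * Real.exp s ≤ 1 + Real.exp z := by nlinarith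
    rw [abs_of_nonpos h, neg_neg, mul_comm (Real.exp s)]
    gcongr

/-- By the mean value theorem the slope is a derivative at a point within `|s|` of `z`, and
self-concordance loses at most the factor `exp (-c)` there. -/
theorem logisticLink_increment_lower_bound {w c z s : ℝ} (hw : w ≤ Real.exp (-c)) (hs : |s| ≤ c) :
    w * (deriv logisticLink z * s ^ 2) ≤ (logisticLink (z + s) - logisticLink z) * s := by
  have key : ∀ a, |a| ≤ |s| → w * deriv logisticLink z ≤ deriv logisticLink (z + a) := by
    intro a ha
    refine le_trans ?_ (exp_neg_abs_mul_deriv_logisticLink_le z a)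
    gcongr
    · exact deriv_logisticLink_nonneg z
    · exact hw.trans (Real.exp_le_exp.2 (by linarith))
  have hcont := differentiable_logisticLink.continuous
  rcases lt_trichotomy s 0 with h | h | h
  · obtain ⟨a, ⟨ha1, ha2⟩, ha⟩ := exists_deriv_eq_slope logisticLink (show z + s < z by linarith)
      hcont.continuousOn differentiable_logisticLink.differentiableOn
    have hk := key (a - z) (by rw [abs_of_neg h, abs_of_neg (by linarith)]; linarith)
    rw [add_sub_cancel, ha, le_div_iff₀ (by linarith)] at hk
    nlinarith
  · simp [h]
  · obtain ⟨a, ⟨ha1, ha2⟩, ha⟩ := exists_deriv_eq_slope logisticLink (show z < z + s by linarith)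
      hcont.continuousOn differentiable_logisticLink.differentiableOn
    have hk := key (a - z) (by rw [abs_of_pos h, abs_of_pos (by linarith)]; linarith)
    rw [add_sub_cancel, ha, le_div_iff₀ (by linarith)] at hk
    nlinarith

theorem hasDerivAt_log_one_add_exp (z : ℝ) :
    HasDerivAt (fun z => Real.log (1 + Real.exp z)) (logisticLink z) z :=
  ((Real.hasDerivAt_exp z).const_add 1).log (by positivity)

/-- Tangent line inequality for the convex function `log (1 + exp z)`. -/
theorem logisticLink_mul_sub_le (a c : ℝ) :
    logisticLink a * (c - a) ≤ Real.log (1 + Real.exp c) - Real.log (1 + Real.exp a) := by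
  have hd : Differentiable ℝ fun z => Real.log (1 + Real.exp z) :=
    fun z => (hasDerivAt_log_one_add_exp z).differentiableAt
  rcases lt_trichotomy a c with h | rfl | h
  · obtain ⟨x, hx, hx'⟩ := exists_hasDerivAt_eq_slope _ _ h hd.continuous.continuousOn
      (fun z _ => hasDerivAt_log_one_add_exp z)
    have := monotone_logisticLink hx.1.le
    rw [eq_div_iff (by linarith)] at hx'
    nlinarith
  · simp
  · obtain ⟨x, hx, hx'⟩ := exists_hasDerivAt_eq_slope _ _ h hd.continuous.continuousOn
      (fun z _ => hasDerivAt_log_one_add_exp z)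
    have := monotone_logisticLink hx.2.le
    rw [eq_div_iff (by linarith)] at hx'
    nlinarith

/-! ### The deterministic oracle inequality. -/

theorem dotProduct_weightedGram_mulVec {n M : ℕ} (β : Fin M → ℝ) (x : Fin n → Fin M → ℝ)
    (v : Fin M → ℝ) :
    dotProduct v ((weightedGram β x).mulVec v) =
      (1 / (n : ℝ)) * ∑ i, deriv logisticLink (dotProduct β (x i)) * dotProduct v (x i) ^ 2 := by
  simp only [dotProduct, Matrix.mulVec, weightedGram, Matrix.of_apply, sq,
    Finset.mul_sum, Finset.sum_mul]
  rw [Finset.sum_comm_cycle]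
  refine Finset.sum_congr rfl fun i _ => Finset.sum_congr rfl fun j _ =>
    Finset.sum_congr rfl fun k _ => ?_
  ring

theorem abs_dotProduct_le_l1Norm {M : ℕ} {L : ℝ} {v x : Fin M → ℝ} (hx : ∀ j, |x j| ≤ L) :
    |dotProduct v x| ≤ L * l1Norm v := by
  unfold dotProduct l1Norm
  rw [Finset.mul_sum]
  refine (Finset.abs_sum_le_sum_abs _ _).trans (Finset.sum_le_sum fun j _ => ?_)
  rw [abs_mul, mul_comm]
  exact mul_le_mul_of_nonneg_right (hx j) (abs_nonneg _)

theorem l1Norm_eq_add {M : ℕ} (I : Finset (Fin M)) (v : Fin M → ℝ) :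
    l1Norm v = ∑ j ∈ I, |v j| + ∑ j ∈ Iᶜ, |v j| :=
  (Finset.sum_add_sum_compl I _).symm

/-- On the active set this is the triangle inequality; off it `β` vanishes, so `γ` and `γ - β`
agree. -/
theorem l1Norm_sub_l1Norm_le {M : ℕ} (β γ : Fin M → ℝ) :
    l1Norm β - l1Norm γ ≤
      ∑ j ∈ activeSet β, |γ j - β j| - ∑ j ∈ (activeSet β)ᶜ, |γ j - β j| := by
  rw [l1Norm_eq_add (activeSet β) β, l1Norm_eq_add (activeSet β) γ]
  have h1 : ∑ j ∈ activeSet β, |β j| ≤ ∑ j ∈ activeSet β, (|γ j| + |γ j - β j|) := by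
    refine Finset.sum_le_sum fun j _ => ?_
    have := abs_sub_abs_le_abs_sub (β j) (γ j)
    rw [abs_sub_comm] at this
    linarith
  have h0 : ∀ j ∈ (activeSet β)ᶜ, β j = 0 := by
    intro j hj
    simpa [activeSet] using hj
  have h2 : ∑ j ∈ (activeSet β)ᶜ, |β j| = 0 :=
    Finset.sum_eq_zero fun j hj => by simp [h0 j hj]
  have h3 : ∑ j ∈ (activeSet β)ᶜ, |γ j - β j| = ∑ j ∈ (activeSet β)ᶜ, |γ j| :=
    Finset.sum_congr rfl fun j hj => by simp [h0 j hj]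
  rw [Finset.sum_add_distrib] at h1
  linarith

/-- First order condition for a minimizer of the penalized risk, along the segment from `β` to
the minimizer `γ`. -/
theorem gradient_le_of_minimizer {n M : ℕ} {r : ℝ} (hr : 0 ≤ r)
    {x : Fin n → Fin M → ℝ} {y : Fin n → ℝ} {β γ : Fin M → ℝ}
    (hmin : ∀ θ, penalizedRisk r x y γ ≤ penalizedRisk r x y θ) {t : ℝ} (ht0 : 0 ≤ t)
    (ht1 : t < 1) :
    (1 / (n : ℝ)) * ∑ i, (logisticLink (dotProduct β (x i) + t * dotProduct (γ - β) (x i)) - y i)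
      * dotProduct (γ - β) (x i) ≤ 2 * r * (l1Norm β - l1Norm γ) := by
  have h := hmin (β + t • (γ - β))
  unfold penalizedRisk at h
  have hl1 : l1Norm (β + t • (γ - β)) ≤ (1 - t) * l1Norm β + t * l1Norm γ := by
    unfold l1Norm
    rw [Finset.mul_sum, Finset.mul_sum, ← Finset.sum_add_distrib]
    refine Finset.sum_le_sum fun j _ => ?_
    have : (β + t • (γ - β)) j = (1 - t) * β j + t * γ j := by simp; ring
    rw [this]
    refine (abs_add_le _ _).trans_eq ?_
    rw [abs_mul, abs_mul, abs_of_nonneg ht0, abs_of_nonneg (by linarith : 0 ≤ 1 - t)]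
  -- The tangent is taken at `β + t(γ - β)`, which differs from `γ` by `(1 - t)(γ - β)`; the penalty
  -- term carries the same factor `1 - t`, which cancels at the end because `t < 1`.
  have hloss : (1 - t) * ∑ i, (logisticLink (dotProduct β (x i) + t * dotProduct (γ - β) (x i))
      - y i) * dotProduct (γ - β) (x i) ≤
      ∑ i, logisticLoss γ (x i) (y i) - ∑ i, logisticLoss (β + t • (γ - β)) (x i) (y i) := by
    rw [Finset.mul_sum, ← Finset.sum_sub_distrib]
    refine Finset.sum_le_sum fun i _ => ?_
    have hc := logisticLink_mul_sub_le (dotProduct β (x i) + t * dotProduct (γ - β) (x i))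
      (dotProduct γ (x i))
    simp only [logisticLoss, add_dotProduct, smul_dotProduct, smul_eq_mul]
    have e : dotProduct γ (x i) = dotProduct β (x i) + dotProduct (γ - β) (x i) := by
      rw [sub_dotProduct]; ring
    rw [e] at hc ⊢
    linarith
  have hn : (0 : ℝ) ≤ 1 / (n : ℝ) := by positivity
  have h1 := mul_le_mul_of_nonneg_left hloss hn
  have h2 := mul_le_mul_of_nonneg_left hl1 (by positivity : 0 ≤ 2 * r)
  refine le_of_mul_le_mul_left ?_ (by linarith : 0 < 1 - t)
  linarith

/-- `η` is the radius within which self-concordance costs no more than the factor `w`; the error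
bound only has to lie below it. -/
theorem l1Norm_sub_le_of_minimizer {n M : ℕ} {r L w b ε η : ℝ} (hr : 0 < r) (hw : 0 < w)
    (hw1 : w ≤ 1) (hb : 0 < b) (hε : 0 ≤ ε) (hL : 0 ≤ L)
    {x : Fin n → Fin M → ℝ} {y : Fin n → ℝ} {β γ : Fin M → ℝ}
    (hmin : ∀ θ, penalizedRisk r x y γ ≤ penalizedRisk r x y θ)
    (hx : ∀ i j, |x i j| ≤ L)
    (hscore : ∀ j, |(1 / (n : ℝ)) * ∑ i, (y i - logisticLink (dotProduct β (x i))) * x i j| ≤ r)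
    (hstabil : ∀ v ∈ stabilSet (activeSet β) 3 ε,
      b * ∑ j ∈ activeSet β, v j ^ 2 - ε ≤ dotProduct v ((weightedGram β x).mulVec v))
    (hη : w ≤ Real.exp (-(L * η)))
    (hK : 4 / (w * b) * r * (activeSet β).card + ε / r < η) :
    l1Norm (γ - β) ≤ 4 / (w * b) * r * (activeSet β).card + ε / r := by
  set K := 4 / (w * b) * r * (activeSet β).card + ε / r with hKdef
  have hK0 : 0 ≤ K := by positivity
  by_contra! hlt
  set D := γ - β with hD
  have hDpos : 0 < l1Norm D := hK0.trans_lt hlt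
  -- `a` will be the norm of `tD`: below `|D|₁` so that `t < 1`, below `η` for self-concordance,
  -- above `K` for the contradiction.
  obtain ⟨a, haK, ha⟩ := exists_between (lt_min hlt hK)
  rw [lt_min_iff] at ha
  set t := a / l1Norm D with ht
  have ht0 : 0 < t := div_pos (by linarith) hDpos
  have ht1 : t < 1 := (div_lt_one hDpos).2 ha.1
  have hta : t * l1Norm D = a := div_mul_cancel₀ _ hDpos.ne'
  set I := activeSet β
  have hn : (0 : ℝ) ≤ 1 / (n : ℝ) := by positivity
  have hgrad := gradient_le_of_minimizer hr.le hmin (β := β) ht0.le ht1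
  rw [← hD] at hgrad
  have hpen := l1Norm_sub_l1Norm_le β γ
  have hsc : (1 / (n : ℝ)) * ∑ i, (y i - logisticLink (dotProduct β (x i))) * dotProduct D (x i)
      ≤ r * l1Norm D := by
    have e : (1 / (n : ℝ)) * ∑ i, (y i - logisticLink (dotProduct β (x i))) * dotProduct D (x i)
        = dotProduct D (fun j => (1 / (n : ℝ)) *
          ∑ i, (y i - logisticLink (dotProduct β (x i))) * x i j) := by
      simp only [dotProduct, Finset.mul_sum]
      rw [Finset.sum_comm]
      refine Finset.sum_congr rfl fun j _ => Finset.sum_congr rfl fun i _ => ?_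
      ring
    rw [e]
    exact (le_abs_self _).trans (abs_dotProduct_le_l1Norm hscore)
  have hincr : (1 / (n : ℝ)) * ∑ i, (logisticLink (dotProduct β (x i) + t * dotProduct D (x i))
      - logisticLink (dotProduct β (x i))) * dotProduct D (x i) ≤
      3 * r * ∑ j ∈ I, |D j| - r * ∑ j ∈ Iᶜ, |D j| := by
    have e : (1 / (n : ℝ)) * ∑ i, (logisticLink (dotProduct β (x i) + t * dotProduct D (x i))
      - logisticLink (dotProduct β (x i))) * dotProduct D (x i) =
      (1 / (n : ℝ)) * ∑ i, (logisticLink (dotProduct β (x i) + t * dotProduct D (x i)) - y i)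
        * dotProduct D (x i) + (1 / (n : ℝ)) * ∑ i, (y i - logisticLink (dotProduct β (x i)))
        * dotProduct D (x i) := by
      rw [← mul_add, ← Finset.sum_add_distrib]
      congr 1
      exact Finset.sum_congr rfl fun i _ => by ring
    have h2 := mul_le_mul_of_nonneg_left hpen (by positivity : 0 ≤ 2 * r)
    rw [e]
    rw [l1Norm_eq_add I D] at hsc
    have h3 : ∀ j, D j = γ j - β j := fun j => rfl
    simp only [← h3] at h2
    linarith
  have hlow : w * dotProduct (t • D) ((weightedGram β x).mulVec (t • D)) ≤
      t * ((1 / (n : ℝ)) * ∑ i, (logisticLink (dotProduct β (x i) + t * dotProduct D (x i))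
      - logisticLink (dotProduct β (x i))) * dotProduct D (x i)) := by
    rw [dotProduct_weightedGram_mulVec, mul_left_comm, mul_left_comm t]
    refine mul_le_mul_of_nonneg_left ?_ hn
    rw [Finset.mul_sum, Finset.mul_sum]
    refine Finset.sum_le_sum fun i _ => ?_
    have hs : |t * dotProduct D (x i)| ≤ L * η := by
      rw [abs_mul, abs_of_pos ht0]
      calc t * |dotProduct D (x i)| ≤ t * (L * l1Norm D) := by
            gcongr; exact abs_dotProduct_le_l1Norm (hx i)
        _ = L * a := by rw [← hta]; ring
        _ ≤ L * η := by gcongr; exact ha.2.le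
    have := logisticLink_increment_lower_bound (z := dotProduct β (x i)) hη hs
    rw [smul_dotProduct, smul_eq_mul]
    linarith
  have hgram : 0 ≤ w * dotProduct (t • D) ((weightedGram β x).mulVec (t • D)) := by
    rw [dotProduct_weightedGram_mulVec]
    exact mul_nonneg hw.le (mul_nonneg hn (Finset.sum_nonneg fun i _ =>
      mul_nonneg (deriv_logisticLink_nonneg _) (sq_nonneg _)))
  have hup := hlow.trans (mul_le_mul_of_nonneg_left hincr ht0.le)
  have habs : ∀ J : Finset (Fin M), ∑ j ∈ J, |(t • D) j| = t * ∑ j ∈ J, |D j| := by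
    intro J
    simp [abs_mul, abs_of_pos ht0, Finset.mul_sum]
  -- The quadratic form is nonnegative, hence so is its upper bound; this is the cone condition,
  -- even without `ε`.
  have hcone : t • D ∈ stabilSet I 3 ε := by
    simp only [stabilSet, Set.mem_ofPred_eq, habs]
    have := hgram.trans hup
    have : 0 ≤ r * (3 * (t * ∑ j ∈ I, |D j|) - t * ∑ j ∈ Iᶜ, |D j|) := by linarith
    have := nonneg_of_mul_nonneg_right this hr
    linarith
  have hst := mul_le_mul_of_nonneg_left (hstabil _ hcone) hw.le
  -- The coefficient is `4 = 3 + 1`: adding `r|tD|₁` to both sides cancels the inactive part and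
  -- raises the active `3r` to `4r`.
  have hyoung : 4 * r * ∑ j ∈ I, |(t • D) j| ≤
      w * b * ∑ j ∈ I, (t • D) j ^ 2 + r * (4 / (w * b) * r * I.card) := by
    have e : r * (4 / (w * b) * r * I.card) = ∑ _j ∈ I, 4 * r ^ 2 / (w * b) := by
      rw [Finset.sum_const, nsmul_eq_mul]; ring
    rw [e, Finset.mul_sum, Finset.mul_sum, ← Finset.sum_add_distrib]
    refine Finset.sum_le_sum fun j _ => ?_
    rw [← sq_abs ((t • D) j)]
    have hwb : 0 < w * b := mul_pos hw hb
    have h0 : 0 ≤ (w * b * |(t • D) j| - 2 * r) ^ 2 / (w * b) := by positivity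
    have e2 : (w * b * |(t • D) j| - 2 * r) ^ 2 / (w * b) =
        w * b * |(t • D) j| ^ 2 + 4 * r ^ 2 / (w * b) - 4 * r * |(t • D) j| := by
      field_simp
      ring
    linarith
  rw [habs] at hyoung
  have hsplit : a = t * ∑ j ∈ I, |D j| + t * ∑ j ∈ Iᶜ, |D j| := by
    rw [← hta, l1Norm_eq_add I D]; ring
  have hwε : w * ε ≤ ε := mul_le_of_le_one_left hε hw1
  have hrK : r * K = r * (4 / (w * b) * r * I.card) + ε := by
    rw [hKdef, mul_add, mul_div_cancel₀ _ hr.ne']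
  have : r * a ≤ r * K := by
    rw [hrK, hsplit]
    linarith
  exact absurd (le_of_mul_le_mul_left this hr) (not_le.2 haK)

/-! ### Almost sure stability and concentration of the score. -/

/-- The estimation error is random, so one null set must serve all `v`. A countable dense subset of
the cone provides it, since the inequality is closed in `v`. -/
theorem LStabil.ae_forall {Ω : Type*} [MeasurableSpace Ω] {μ : Measure Ω} {n M : ℕ}
    {X : Fin n → Ω → Fin M → ℝ} {β : Fin M → ℝ} {α ε b : ℝ} (h : LStabil μ X β α ε b) :
    ∀ᵐ ω ∂μ, ∀ v ∈ stabilSet (activeSet β) α ε, b * ∑ j ∈ activeSet β, v j ^ 2 - ε ≤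
      dotProduct v ((weightedGram β fun i => X i ω).mulVec v) := by
  obtain ⟨t, hts, htc, hst⟩ := (TopologicalSpace.IsSeparable.of_separableSpace
    (stabilSet (activeSet β) α ε)).exists_countable_dense_subset
  have hae : ∀ᵐ ω ∂μ, ∀ v ∈ t, b * ∑ j ∈ activeSet β, v j ^ 2 - ε ≤
      dotProduct v ((weightedGram β fun i => X i ω).mulVec v) :=
    (ae_ball_iff htc).2 fun v hv => h v (hts hv)
  filter_upwards [hae] with ω hω v hv
  have hclosed : IsClosed {v : Fin M → ℝ | b * ∑ j ∈ activeSet β, v j ^ 2 - ε ≤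
      dotProduct v ((weightedGram β fun i => X i ω).mulVec v)} :=
    isClosed_le (by fun_prop) (by simp only [dotProduct, Matrix.mulVec]; fun_prop)
  exact closure_minimal (fun v hv => hω v hv) hclosed (hst hv)

/-- Hoeffding's inequality, applied to `Z` and to `-Z`. -/
theorem measureReal_le_abs_sum_of_bounded {Ω : Type*} [MeasurableSpace Ω] {μ : Measure Ω}
    [IsProbabilityMeasure μ] {n : ℕ} {Z : Fin n → Ω → ℝ} {L t : ℝ} (ht : 0 ≤ t)
    (hm : ∀ i, AEMeasurable (Z i) μ) (hindep : iIndepFun Z μ)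
    (hbd : ∀ i, ∀ᵐ ω ∂μ, |Z i ω| ≤ L) (hmean : ∀ i, μ[Z i] = 0) :
    μ.real {ω | t ≤ |∑ i, Z i ω|} ≤ 2 * Real.exp (-t ^ 2 / (2 * (n * L ^ 2))) := by
  have hsub : ∀ i, HasSubgaussianMGF (Z i) ((‖L - (-L)‖₊ / 2) ^ 2) μ := fun i =>
    hasSubgaussianMGF_of_mem_Icc_of_integral_eq_zero (hm i)
      ((hbd i).mono fun ω h => abs_le.1 h) (hmean i)
  have hc : ((∑ _i : Fin n, (‖L - (-L)‖₊ / 2) ^ 2 : NNReal) : ℝ) = n * L ^ 2 := by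
    simp only [Finset.sum_const, Finset.card_univ, Fintype.card_fin, nsmul_eq_mul]
    push_cast
    rw [Real.norm_eq_abs, show L - -L = 2 * L by ring, div_pow, sq_abs]
    ring
  have h1 := HasSubgaussianMGF.measure_sum_ge_le_of_iIndepFun hindep (s := Finset.univ)
    (fun i _ => hsub i) ht
  have h2 := HasSubgaussianMGF.measure_sum_ge_le_of_iIndepFun
    (hindep.comp (fun _ x => -x) fun _ => measurable_neg) (s := Finset.univ)
    (fun i _ => (hsub i).neg) ht
  rw [hc] at h1 h2
  calc μ.real {ω | t ≤ |∑ i, Z i ω|}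
      ≤ μ.real ({ω | t ≤ ∑ i, Z i ω} ∪ {ω | t ≤ ∑ i, -Z i ω}) := by
        refine measureReal_mono fun ω hω => ?_
        rcases le_abs.1 (show t ≤ |∑ i, Z i ω| from hω) with h | h
        · exact Or.inl h
        · refine Or.inr ?_
          simpa [Finset.sum_neg_distrib] using h
    _ ≤ _ := measureReal_union_le _ _
    _ ≤ _ := by
      rw [two_mul]
      exact add_le_add h1 h2

theorem measurable_logisticLink : Measurable logisticLink :=
  differentiable_logisticLink.continuous.measurable

namespace IsLogisticModel

variable {Ω : Type*} [MeasurableSpace Ω] {μ : Measure Ω} {n M : ℕ}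
  {X : Fin n → Ω → Fin M → ℝ} {Y : Fin n → Ω → ℝ} {β : Fin M → ℝ} {L : ℝ}

theorem abs_score_le (h : IsLogisticModel μ X Y β L) (i : Fin n) (j : Fin M) :
    ∀ᵐ ω ∂μ, |(Y i ω - logisticLink (dotProduct β (X i ω))) * X i ω j| ≤ L := by
  filter_upwards [h.binary i, h.bounded i j] with ω hY hX
  have h0 := logisticLink_nonneg (dotProduct β (X i ω))
  have h1 := logisticLink_le_one (dotProduct β (X i ω))
  have : |Y i ω - logisticLink (dotProduct β (X i ω))| ≤ 1 := by
    rw [abs_le]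
    rcases hY with hY | hY <;> rw [hY] <;> constructor <;> linarith
  rw [abs_mul]
  exact (mul_le_of_le_one_left (abs_nonneg _) this).trans hX

theorem measurable_score_fun (β : Fin M → ℝ) (j : Fin M) :
    Measurable fun p : (Fin M → ℝ) × ℝ =>
      (p.2 - logisticLink (dotProduct β p.1)) * p.1 j := by
  have : Measurable fun p : (Fin M → ℝ) × ℝ => dotProduct β p.1 := by
    simp only [dotProduct]; fun_prop
  have := measurable_logisticLink.comp this
  simp only [Function.comp_def] at this
  fun_prop

theorem measurable_score (h : IsLogisticModel μ X Y β L) (i : Fin n) (j : Fin M) :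
    Measurable fun ω => (Y i ω - logisticLink (dotProduct β (X i ω))) * X i ω j :=
  (measurable_score_fun β j).comp ((h.measurable_X i).prodMk (h.measurable_Y i))

theorem iIndepFun_score (h : IsLogisticModel μ X Y β L) (j : Fin M) :
    iIndepFun (fun i ω => (Y i ω - logisticLink (dotProduct β (X i ω))) * X i ω j) μ :=
  h.indep.comp (fun _ p => (p.2 - logisticLink (dotProduct β p.1)) * p.1 j)
    fun _ => measurable_score_fun β j

/-- Condition on `X i` and pull out the factor `X i ω j`. -/
theorem integral_score_eq_zero [IsProbabilityMeasure μ]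
    (h : IsLogisticModel μ X Y β L) (i : Fin n) (j : Fin M) :
    ∫ ω, (Y i ω - logisticLink (dotProduct β (X i ω))) * X i ω j ∂μ = 0 := by
  have hm : MeasurableSpace.comap (X i) inferInstance ≤ ‹MeasurableSpace Ω› :=
    (h.measurable_X i).comap_le
  have hXj : Measurable fun ω => X i ω j := (measurable_pi_apply j).comp (h.measurable_X i)
  have hXj' : StronglyMeasurable[MeasurableSpace.comap (X i) inferInstance]
      fun ω => X i ω j :=
    ((measurable_pi_apply j).comp (comap_measurable (X i))).stronglyMeasurable
  have hY1 : ∀ᵐ ω ∂μ, ‖Y i ω‖ ≤ 1 := by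
    filter_upwards [h.binary i] with ω hω
    rcases hω with hω | hω <;> simp [hω]
  have hXL : ∀ᵐ ω ∂μ, ‖X i ω j‖ ≤ L := h.bounded i j
  have hYint : Integrable (Y i) μ :=
    .of_bound (h.measurable_Y i).aestronglyMeasurable 1 hY1
  have hYX : Integrable (Y i * fun ω => X i ω j) μ :=
    hYint.mul_bdd hXj.aestronglyMeasurable hXL
  have hZ : Integrable (fun ω => (Y i ω - logisticLink (dotProduct β (X i ω))) * X i ω j) μ :=
    .of_bound (h.measurable_score i j).aestronglyMeasurable L (h.abs_score_le i j)
  have hgX : Integrable (fun ω => logisticLink (dotProduct β (X i ω)) * X i ω j) μ := by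
    refine (hYX.sub hZ).congr (Eventually.of_forall fun ω => ?_)
    simp only [Pi.sub_apply, Pi.mul_apply]
    ring
  have hpull := condExp_mul_of_stronglyMeasurable_right hXj' hYX hYint
  have e : ∫ ω, (Y i * fun ω => X i ω j) ω ∂μ =
      ∫ ω, logisticLink (dotProduct β (X i ω)) * X i ω j ∂μ := by
    rw [← integral_condExp hm]
    refine integral_congr_ae ?_
    filter_upwards [hpull, h.condMean i] with ω h1 h2
    rw [h1, Pi.mul_apply, h2]
  simp only [sub_mul]
  refine (integral_sub hYX hgX).trans ?_
  rw [e, sub_self]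

theorem measureReal_exists_lt_abs_score_le [IsProbabilityMeasure μ]
    (h : IsLogisticModel μ X Y β L) (hL : 0 < L)
    (hn : 1 ≤ n) {r : ℝ} (hr : 2 * L * √(2 * Real.log (2 * (max M n : ℕ)) / n) ≤ r) :
    μ.real {ω | ∃ j, r < |(1 / (n : ℝ)) *
      ∑ i, (Y i ω - logisticLink (dotProduct β (X i ω))) * X i ω j|} ≤ 1 / n := by
  set m : ℕ := max M n with hmdef
  have hMm : (M : ℝ) ≤ m := by exact_mod_cast le_max_left M n
  have hnm : (n : ℝ) ≤ m := by exact_mod_cast le_max_right M n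
  have hn0 : (1 : ℝ) ≤ n := by exact_mod_cast hn
  have hr0 : 0 ≤ r := le_trans (by positivity) hr
  have hlog : 0 ≤ Real.log (2 * (m : ℝ)) := Real.log_nonneg (by linarith)
  have hsq : 4 * L ^ 2 * (2 * Real.log (2 * (m : ℝ)) / n) ≤ r ^ 2 := by
    have := pow_le_pow_left₀ (by positivity) hr 2
    rw [mul_pow, Real.sq_sqrt (by positivity)] at this
    linarith
  -- The lower bound on `r` would even give the exponent `-4 log (2m)`; half of it suffices, as the
  -- union bound then totals at most `1/(2m)`.
  have hexp : Real.exp (-(n * r) ^ 2 / (2 * (n * L ^ 2))) ≤ ((2 * (m : ℝ)) ^ 2)⁻¹ := by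
    have e : ((2 * (m : ℝ)) ^ 2)⁻¹ = Real.exp (-(2 * Real.log (2 * (m : ℝ)))) := by
      rw [Real.exp_neg, two_mul (Real.log _), Real.exp_add, Real.exp_log (by linarith), sq]
    rw [e]
    refine Real.exp_le_exp.2 ?_
    rw [neg_div, neg_le_neg_iff, le_div_iff₀ (by positivity)]
    have h1 := mul_le_mul_of_nonneg_left hsq (by positivity : 0 ≤ (n : ℝ) ^ 2)
    have e2 : (n : ℝ) ^ 2 * (4 * L ^ 2 * (2 * Real.log (2 * (m : ℝ)) / n)) =
        8 * (n * L ^ 2 * Real.log (2 * (m : ℝ))) := by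
      field_simp
      ring
    have h2 : 0 ≤ n * L ^ 2 * Real.log (2 * (m : ℝ)) := by positivity
    linarith
  calc _ ≤ μ.real (⋃ j, {ω | n * r ≤
        |∑ i, (Y i ω - logisticLink (dotProduct β (X i ω))) * X i ω j|}) := by
        refine measureReal_mono ?_
        rintro ω ⟨j, hj⟩
        refine Set.mem_iUnion.2 ⟨j, ?_⟩
        rw [abs_mul, abs_of_nonneg (by positivity), one_div, ← div_eq_inv_mul,
          lt_div_iff₀ (by linarith)] at hj
        show n * r ≤ _
        linarith
    _ ≤ ∑ j : Fin M, μ.real {ω | n * r ≤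
        |∑ i, (Y i ω - logisticLink (dotProduct β (X i ω))) * X i ω j|} :=
        measureReal_iUnion_fintype_le _
    _ ≤ ∑ _j : Fin M, 2 * ((2 * (m : ℝ)) ^ 2)⁻¹ := by
        refine Finset.sum_le_sum fun j _ => ?_
        refine (measureReal_le_abs_sum_of_bounded (by positivity)
          (fun i => (h.measurable_score i j).aemeasurable) (h.iIndepFun_score j)
          (fun i => h.abs_score_le i j) fun i => h.integral_score_eq_zero i j).trans ?_
        gcongr
    _ = M * (2 * ((2 * (m : ℝ)) ^ 2)⁻¹) := by simp
    _ ≤ m * (2 * ((2 * (m : ℝ)) ^ 2)⁻¹) := by gcongr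
    _ = 1 / (2 * m) := by
        have : (m : ℝ) ≠ 0 := by linarith
        field_simp
    _ ≤ 1 / n := one_div_le_one_div_of_le (by linarith) (by linarith)

end IsLogisticModel

/-! ### Consequences of the tuning bound and the limit. -/

theorem le_of_tuningBound_le {L r δ : ℝ} {M n : ℕ} (hL : 0 ≤ L)
    (h : tuningBound L M n δ ≤ r) :
    2 * L * √(2 * Real.log (2 * (max M n : ℕ)) / n) ≤ r ∧ 1 / (4 * (max M n : ℕ)) ≤ r := by
  unfold tuningBound at h
  have h2 : 0 ≤ 2 * L * √(2 * Real.log (1 / δ) / n) := by positivity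
  have h3 : (0 : ℝ) ≤ 1 / (4 * (max M n : ℕ)) := by positivity
  have h4 : 2 * L * √(2 * Real.log (2 * (max M n : ℕ)) / n) ≤
      (6 + 4 * √2) * L * √(2 * Real.log (2 * (max M n : ℕ)) / n) := by
    gcongr
    linarith [Real.sqrt_nonneg 2]
  have h5 : 0 ≤ 2 * L * √(2 * Real.log (2 * (max M n : ℕ)) / n) := by positivity
  constructor <;> linarith

theorem slack_nonneg {M n : ℕ} {r : ℝ} (hr : 0 ≤ r) : 0 ≤ slack M n r := by
  unfold slack
  have := Real.log_nonneg one_le_two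
  positivity

/-- With `m = M ∨ n`, the bound `1/r ≤ 4m` gives `ε/r ≤ 8 log 2 · m²/2^m`, and `m ≥ n` tends to
infinity. -/
theorem tendsto_slack_div {M : ℕ → ℕ} {r : ℕ → ℝ}
    (hr : ∀ n, 1 ≤ n → 1 / (4 * (max (M n) n : ℕ)) ≤ r n) :
    Tendsto (fun n => slack (M n) n (r n) / r n) atTop (𝓝 0) := by
  have hmax : Tendsto (fun n => max (M n) n) atTop atTop :=
    tendsto_atTop_mono (fun n => le_max_right _ _) tendsto_id
  have hlim : Tendsto (fun m : ℕ => 8 * Real.log 2 * ((m : ℝ) ^ 2 / 2 ^ m)) atTop (𝓝 0) := by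
    simpa using (tendsto_pow_const_div_const_pow_of_one_lt 2 (one_lt_two (α := ℝ))).const_mul
      (8 * Real.log 2)
  have hlog := Real.log_nonneg one_le_two
  refine squeeze_zero' ?_ ?_ (hlim.comp hmax)
  · filter_upwards [eventually_ge_atTop 1] with n hn
    have : 0 ≤ r n := le_trans (by positivity) (hr n hn)
    exact div_nonneg (slack_nonneg this) this
  · filter_upwards [eventually_ge_atTop 1] with n hn
    have hm : (1 : ℝ) ≤ (max (M n) n : ℕ) := by exact_mod_cast hn.trans (le_max_right _ _)
    set m := max (M n) n
    have hrn : 1 / r n ≤ 4 * m := by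
      have := one_div_le_one_div_of_le (by positivity) (hr n hn)
      rwa [one_div_one_div] at this
    have hr0 : 0 < r n := lt_of_lt_of_le (by positivity) (hr n hn)
    calc slack (M n) n (r n) / r n = Real.log 2 / 2 ^ (m + 1) * (1 / r n * (1 / r n)) := by
          unfold slack; ring
      _ ≤ Real.log 2 / 2 ^ (m + 1) * (4 * m * (4 * m)) := by gcongr
      _ = 8 * Real.log 2 * ((m : ℝ) ^ 2 / 2 ^ m) := by rw [pow_succ]; field_simp; ring

theorem theorem2p6
    {Ω : ℕ → Type*} [∀ n, MeasurableSpace (Ω n)]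
    (μ : ∀ n, Measure (Ω n)) [∀ n, IsProbabilityMeasure (μ n)]
    (M : ℕ → ℕ)
    (X : ∀ n, Fin n → Ω n → Fin (M n) → ℝ) (Y : ∀ n, Fin n → Ω n → ℝ)
    (β : ∀ n, Fin (M n) → ℝ)
    (L B b : ℝ) (hL : 0 < L) (hB : 0 < B) (hb : 0 < b) (hb1 : b ≤ 1)
    (hmodel : ∀ n, 1 ≤ n → IsLogisticModel (μ n) (X n) (Y n) (β n) L)
    (δ r : ℕ → ℝ) (hδ : ∀ n, 0 < δ n) (hδ0 : Tendsto δ atTop (𝓝 0))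
    (hr : ∀ n, 1 ≤ n → tuningBound L (M n) n (δ n) ≤ r n)
    (hstabil : ∀ n, 1 ≤ n → LStabil (μ n) (X n) (β n) 3 (slack (M n) n (r n)) b)
    (hmax : ∀ n, ∀ j ∈ activeSet (β n), |β n j| ≤ B)
    (hkr : Tendsto (fun n => ((activeSet (β n)).card : ℝ) * r n) atTop (𝓝 0))
    (βt : ∀ n, Ω n → Fin (M n) → ℝ) (hβt : ∀ n, AEMeasurable (βt n) (μ n))
    (hmin : ∀ n, 1 ≤ n → ∀ᵐ ω ∂(μ n), ∀ γ : Fin (M n) → ℝ,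
      penalizedRisk (r n) (fun i => X n i ω) (fun i => Y n i ω) (βt n ω) ≤
        penalizedRisk (r n) (fun i => X n i ω) (fun i => Y n i ω) γ) :
    ∀ w : ℝ, 0 < w → w < 1 →
      Tendsto (fun n => (μ n).real {ω | l1Norm (βt n ω - β n) ≤
        4 / (w * b) * r n * (activeSet (β n)).card
          + (1 + 1 / r n) * slack (M n) n (r n)}) atTop (𝓝 1) := by
  intro w hw hw1
  set S : ∀ n, Set (Ω n) := fun n => {ω | l1Norm (βt n ω - β n) ≤
    4 / (w * b) * r n * (activeSet (β n)).card + (1 + 1 / r n) * slack (M n) n (r n)}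
  obtain ⟨η, hη0, hη⟩ : ∃ η : ℝ, 0 < η ∧ w ≤ Real.exp (-(L * η)) := by
    refine ⟨-Real.log w / L, div_pos (neg_pos.2 (Real.log_neg hw hw1)) hL, ?_⟩
    rw [mul_div_cancel₀ _ hL.ne', neg_neg, Real.exp_log hw]
  have hr1 := fun n hn => le_of_tuningBound_le hL.le (hr n hn)
  have hsmall : Tendsto (fun n => 4 / (w * b) * r n * (activeSet (β n)).card +
      slack (M n) n (r n) / r n) atTop (𝓝 0) := by
    have h := (hkr.const_mul (4 / (w * b))).add (tendsto_slack_div fun n hn => (hr1 n hn).2)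
    simp only [mul_zero, add_zero] at h
    refine h.congr fun n => ?_
    ring
  have hlow : Tendsto (fun n : ℕ => 1 - 1 / (n : ℝ)) atTop (𝓝 1) := by
    simpa using tendsto_one_div_atTop_nhds_zero_nat.const_sub (1 : ℝ)
  refine tendsto_of_tendsto_of_tendsto_of_le_of_le' hlow tendsto_const_nhds ?_
    (Eventually.of_forall fun n => measureReal_le_one)
  filter_upwards [eventually_ge_atTop 1, hsmall.eventually_lt_const hη0] with n hn hKn
  have hmpos : (0 : ℝ) < (max (M n) n : ℕ) := by exact_mod_cast lt_max_of_lt_right hn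
  have hrpos : 0 < r n := lt_of_lt_of_le (by positivity) (hr1 n hn).2
  have hε := slack_nonneg (M := M n) (n := n) hrpos.le
  have hbad := (hmodel n hn).measureReal_exists_lt_abs_score_le hL hn (hr1 n hn).1
  set E := {ω | ∃ j, r n < |(1 / (n : ℝ)) *
    ∑ i, (Y n i ω - logisticLink (dotProduct (β n) (X n i ω))) * X n i ω j|}
  have hX : ∀ᵐ ω ∂(μ n), ∀ i j, |X n i ω j| ≤ L :=
    ae_all_iff.2 fun i => ae_all_iff.2 fun j => (hmodel n hn).bounded i j
  have hcover : (Set.univ : Set (Ω n)) ≤ᵐ[μ n] (E ∪ S n : Set (Ω n)) := by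
    filter_upwards [hX, hmin n hn, (hstabil n hn).ae_forall] with ω hXω hminω hstabω _
    by_cases hω : ω ∈ E
    · exact Or.inl hω
    · refine Or.inr ?_
      have hscore : ∀ j, |(1 / (n : ℝ)) *
          ∑ i, (Y n i ω - logisticLink (dotProduct (β n) (X n i ω))) * X n i ω j| ≤ r n :=
        fun j => not_lt.1 fun hj => hω ⟨j, hj⟩
      have := l1Norm_sub_le_of_minimizer hrpos hw hw1.le hb hε hL.le hminω hXω hscore hstabω
        hη hKn
      refine this.trans ?_
      have e : (1 + 1 / r n) * slack (M n) n (r n) =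
        slack (M n) n (r n) + slack (M n) n (r n) / r n := by ring
      rw [e]
      linarith
  have h1 : (1 : ℝ) ≤ (μ n).real (E ∪ S n) := by
    rw [← probReal_univ (μ := μ n)]
    exact ENNReal.toReal_mono (measure_ne_top _ _) (measure_mono_ae hcover)
  have h2 := measureReal_union_le (μ := μ n) E (S n)
  linarith
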